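/- Let $N\ge 1$ be an integer and $\zeta_N=e^{2\pi i/N}$, and let $\mathbb{Z}_N$ be the cyclic group of integers modulo $N$. Call a subset of $\mathbb{Z}_N$ primitive if it is not contained in a coset of a proper subgroup of $\mathbb{Z}_N$. Call nonempty subsets $S,T\subseteq\mathbb{Z}_N$ formally dual if for every $y\in\mathbb{Z}_N$ $$\Bigl|\frac{1}{|S|}\sum_{x\in S}\zeta_N^{xy}\Bigr|^2=\frac{1}{|T|}\,\#\{(t,t')\in T\times T : t-t'=y\}.$$ Theorem. Let $p$ be a prime with $p\mid N$ and $p^2\nmid N$, and suppose that $p^j\equiv-1 \pmod{N/p}$ for some integer $j$. Then there is no pair of primitive subsets $S,T\subseteq\mathbb{Z}_N$ that are formally dual. (The number of distinct prime factors of $N$ is not restricted.) -/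

import Mathlib

/-- A subset `T` of an additive group is primitive if it is not contained in any coset `a + H`
of a proper subgroup `H`. -/
def IsPrimitiveSubset {G : Type*} [AddCommGroup G] (T : Finset G) : Prop :=
  ∀ (H : AddSubgroup G) (a : G), H ≠ ⊤ → ¬ ∀ t ∈ T, t - a ∈ H

/-- The weight enumerator of `T`: the number of pairs `(t, t') ∈ T × T` with `t - t' = y`. -/
def weightEnumerator {G : Type*} [AddCommGroup G] [DecidableEq G] (T : Finset G) (y : G) : ℕ :=
  ((T ×ˢ T).filter fun q => q.1 - q.2 = y).card

/-- Nonempty subsets `S`, `T` of `ℤ/Nℤ` are formally dual if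
`|(1/|S|) ∑_{x ∈ S} ζ_N^{xy}|² = (1/|T|) #{(t, t') ∈ T × T : t - t' = y}` for every `y`,
where `ζ_N = exp (2πi/N)`; here `ZMod.stdAddChar (x * y)` is `ζ_N^{xy}`. -/
def IsFormallyDual {N : ℕ} [NeZero N] (S T : Finset (ZMod N)) : Prop :=
  S.Nonempty ∧ T.Nonempty ∧
    ∀ y : ZMod N,
      ‖(1 / (S.card : ℂ)) * ∑ x ∈ S, (ZMod.stdAddChar (x * y) : ℂ)‖ ^ 2 =
        (1 / (T.card : ℝ)) * (weightEnumerator T y : ℝ)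

/-!
Write `m = N / p`, which is prime to `p`, and let `S`, `T` be formally dual. Fourier inversion shows
that formal duality is symmetric and that `|S| |T| = N`, so exactly one of the two cardinalities is
divisible by `p`; by symmetry let it be `|T|`.

The number `|S|² ν_T(y) / |T| = |∑_{x ∈ S} ζ^{xy}|²` is rational and an algebraic integer, so it is
an integer, and `p ∣ ν_T(y)` for all `y` (`IsFormallyDual.dvd_weightEnumerator`). Let `c` be the
image of `T` in the group algebra `𝔽_p[ℤ/m]` and `c*` the image of `-T`. Then `c c* = ∑ ν_T(y) [y]`
vanishes, while the Frobenius map gives `c ^ p ^ n = c*` as soon as `p ^ n ≡ -1` modulo `m`. So `c`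
is nilpotent; as Frobenius merely permutes the coefficients of `c`, it follows that `c = 0`
(`AddMonoidAlgebra.sum_single_eq_zero`). Hence every fibre of `T` over `ℤ/m` has size divisible by
`p`, that is, size `0` or `p`, and `T` is invariant under translation by `m`
(`add_mem_of_dvd_card_fiber`).

The Fourier transform of `T` is then supported on the proper subgroup `{y | m y = 0}`; by duality
so is `ν_S`, and `S` is not primitive (`IsFormallyDual.not_isPrimitiveSubset`).
-/

/-! ### Weight enumerators and Fourier transforms -/

theorem sum_weightEnumerator_smul {G M : Type*} [AddCommGroup G] [DecidableEq G] [Fintype G]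
    [AddCommMonoid M] (T : Finset G) (f : G → M) :
    ∑ y, weightEnumerator T y • f y = ∑ s ∈ T, ∑ t ∈ T, f (s - t) := by
  rw [← Finset.sum_product', ← Finset.sum_fiberwise (T ×ˢ T) (fun q => q.1 - q.2)]
  refine Finset.sum_congr rfl fun y _ => ?_
  rw [weightEnumerator, ← Finset.sum_const]
  refine Finset.sum_congr rfl fun q hq => ?_
  rw [(Finset.mem_filter.mp hq).2]

theorem weightEnumerator_neg {G : Type*} [AddCommGroup G] [DecidableEq G] (T : Finset G) (y : G) :
    weightEnumerator T (-y) = weightEnumerator T y := by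
  refine Finset.card_nbij' Prod.swap Prod.swap ?_ ?_ ?_ ?_
  · rintro ⟨a, b⟩ h
    simp only [Finset.coe_filter, Finset.mem_product, Set.mem_ofPred_eq, Prod.swap] at h ⊢
    exact ⟨h.1.symm, by rw [← neg_sub, h.2, neg_neg]⟩
  · rintro ⟨a, b⟩ h
    simp only [Finset.coe_filter, Finset.mem_product, Set.mem_ofPred_eq, Prod.swap] at h ⊢
    exact ⟨h.1.symm, by rw [← neg_sub, h.2]⟩
  · intro q _; rfl
  · intro q _; rfl

theorem weightEnumerator_zero {G : Type*} [AddCommGroup G] [DecidableEq G] (T : Finset G) :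
    weightEnumerator T 0 = T.card := by
  refine (Finset.card_nbij' (fun t => (t, t)) Prod.fst ?_ ?_ ?_ ?_).symm
  · intro t ht
    simpa using ht
  · rintro ⟨a, b⟩ h
    simp only [Finset.coe_filter, Finset.mem_product, Set.mem_ofPred_eq] at h
    exact h.1.1
  · intro t _; rfl
  · rintro ⟨a, b⟩ h
    simp only [Finset.coe_filter, Finset.mem_product, Set.mem_ofPred_eq, sub_eq_zero] at h
    simp [h.2]

section Fourier

variable {N : ℕ} [NeZero N] {S T : Finset (ZMod N)}

/-- The Fourier transform of the weight enumerator is the squared modulus of the Fourier transform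
of the indicator function. -/
theorem sum_weightEnumerator_mul_stdAddChar (S : Finset (ZMod N)) (y : ZMod N) :
    ∑ z, (weightEnumerator S z : ℂ) * ZMod.stdAddChar (z * y) =
      ((‖∑ x ∈ S, (ZMod.stdAddChar (x * y) : ℂ)‖ ^ 2 : ℝ) : ℂ) := by
  have h := sum_weightEnumerator_smul S fun z => (ZMod.stdAddChar (z * y) : ℂ)
  simp only [nsmul_eq_mul] at h
  rw [h, Complex.ofReal_pow, ← Complex.mul_conj', map_sum, Finset.sum_mul_sum]
  refine Finset.sum_congr rfl fun s _ => Finset.sum_congr rfl fun t _ => ?_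
  rw [← AddChar.map_neg_eq_conj, ← AddChar.map_add_eq_mul]
  congr 1
  ring

/-- Fourier inversion on `ℤ/N`. -/
theorem sum_sum_mul_stdAddChar (f : ZMod N → ℂ) (z : ZMod N) :
    ∑ y, (∑ w, f w * ZMod.stdAddChar (w * y)) * ZMod.stdAddChar (y * z) = N * f (-z) := by
  simp only [Finset.sum_mul]
  rw [Finset.sum_comm]
  have h (w : ZMod N) : ∑ y, f w * (ZMod.stdAddChar (w * y) : ℂ) * ZMod.stdAddChar (y * z) =
      if w = -z then N * f w else 0 := by
    have := AddChar.sum_mulShift (w + z) (ZMod.isPrimitive_stdAddChar N)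
    rw [ZMod.card] at this
    calc _ = f w * ∑ y : ZMod N, (ZMod.stdAddChar (y * (w + z)) : ℂ) := by
          rw [Finset.mul_sum]
          refine Finset.sum_congr rfl fun y _ => ?_
          rw [mul_assoc, ← AddChar.map_add_eq_mul]
          congr 2
          ring
      _ = _ := by
          rw [this]
          by_cases hw : w + z = 0
          · simp [eq_neg_of_add_eq_zero_left hw, mul_comm]
          · simp [hw, mt eq_neg_iff_add_eq_zero.mp hw]
  simp [h]

/-! ### Formally dual sets -/

namespace IsFormallyDual

/-- Formal duality with the squared modulus expanded and the denominators cleared. -/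
theorem card_mul_sum (h : IsFormallyDual S T) (y : ZMod N) :
    (T.card : ℂ) * ∑ z, (weightEnumerator S z : ℂ) * ZMod.stdAddChar (z * y) =
      (S.card : ℂ) ^ 2 * weightEnumerator T y := by
  obtain ⟨hS, hT, hy⟩ := h
  have hS0 : (S.card : ℝ) ≠ 0 := by exact_mod_cast hS.card_pos.ne'
  have hT0 : (T.card : ℝ) ≠ 0 := by exact_mod_cast hT.card_pos.ne'
  have h1 := hy y
  rw [norm_mul, mul_pow, norm_div, norm_one, Complex.norm_natCast] at h1
  field_simp at h1
  rw [sum_weightEnumerator_mul_stdAddChar]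
  have h2 : (T.card : ℝ) * ‖∑ x ∈ S, (ZMod.stdAddChar (x * y) : ℂ)‖ ^ 2 =
      (S.card : ℝ) ^ 2 * weightEnumerator T y := by linarith
  exact_mod_cast congrArg Complex.ofReal h2

theorem sum_weightEnumerator_right (h : IsFormallyDual S T) (z : ZMod N) :
    (S.card : ℂ) ^ 2 * ∑ y, (weightEnumerator T y : ℂ) * ZMod.stdAddChar (y * z) =
      T.card * (N * weightEnumerator S z) := by
  have := sum_sum_mul_stdAddChar (fun w => (weightEnumerator S w : ℂ)) z
  rw [weightEnumerator_neg] at this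
  rw [← this, Finset.mul_sum, Finset.mul_sum]
  refine Finset.sum_congr rfl fun y _ => ?_
  rw [← mul_assoc, ← h.card_mul_sum y, mul_assoc]

theorem card_mul_card (h : IsFormallyDual S T) : S.card * T.card = N := by
  have h0 := h.sum_weightEnumerator_right 0
  have h1 := sum_weightEnumerator_mul_stdAddChar T 0
  simp only [mul_zero, AddChar.map_zero_eq_one, mul_one, Finset.sum_const, nsmul_eq_mul,
    Complex.norm_natCast] at h0 h1
  rw [h1, weightEnumerator_zero] at h0
  have h2 : S.card ^ 2 * T.card ^ 2 = T.card * (N * S.card) := by exact_mod_cast h0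
  have hS := h.1.card_pos
  have hT := h.2.1.card_pos
  refine Nat.eq_of_mul_eq_mul_left (Nat.mul_pos hS hT) ?_
  linarith

theorem symm (h : IsFormallyDual S T) : IsFormallyDual T S := by
  refine ⟨h.2.1, h.1, fun z => ?_⟩
  have h1 := h.sum_weightEnumerator_right z
  have hN : (S.card : ℂ) * T.card = N := by exact_mod_cast h.card_mul_card
  have hS0 : (S.card : ℝ) ≠ 0 := by exact_mod_cast h.1.card_pos.ne'
  have hT0 : (T.card : ℝ) ≠ 0 := by exact_mod_cast h.2.1.card_pos.ne'
  rw [sum_weightEnumerator_mul_stdAddChar, ← hN] at h1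
  have h2 : (S.card : ℝ) ^ 2 * ‖∑ x ∈ T, (ZMod.stdAddChar (x * z) : ℂ)‖ ^ 2 =
      T.card * (S.card * T.card * weightEnumerator S z) := by exact_mod_cast h1
  rw [norm_mul, mul_pow, norm_div, norm_one, Complex.norm_natCast]
  field_simp
  refine mul_left_cancel₀ hS0 ?_
  linarith

theorem dvd_weightEnumerator (h : IsFormallyDual S T) {p : ℕ} (hp : p.Prime) (hpT : p ∣ T.card)
    (hpS : ¬ p ∣ S.card) (y : ZMod N) : p ∣ weightEnumerator T y := by
  have hT0 : (T.card : ℚ) ≠ 0 := by exact_mod_cast h.2.1.card_pos.ne'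
  have hT0' : (T.card : ℂ) ≠ 0 := by exact_mod_cast h.2.1.card_pos.ne'
  set r : ℚ := (S.card : ℚ) ^ 2 * weightEnumerator T y / T.card with hr
  have hint : IsIntegral ℤ (algebraMap ℚ ℂ r) := by
    have hrc : algebraMap ℚ ℂ r =
        ∑ z, (weightEnumerator S z : ℂ) * ZMod.stdAddChar (z * y) := by
      have := h.card_mul_sum y
      rw [hr, eq_ratCast]
      push_cast
      rw [div_eq_iff hT0', ← this, mul_comm]
    rw [hrc]
    refine IsIntegral.sum _ fun z _ => IsIntegral.mul ?_ ?_
    · rw [← map_natCast (algebraMap ℤ ℂ)]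
      exact isIntegral_algebraMap
    -- Values of the character are roots of unity.
    refine IsIntegral.of_pow (NeZero.pos N) ?_
    rw [← AddChar.map_nsmul_eq_pow]
    simp [isIntegral_one]
  rw [isIntegral_algebraMap_iff (algebraMap ℚ ℂ).injective] at hint
  obtain ⟨k, hk⟩ := IsIntegrallyClosed.isIntegral_iff.mp hint
  have hk2 : (k : ℚ) * T.card = (S.card : ℚ) ^ 2 * weightEnumerator T y := by
    rw [eq_intCast] at hk
    rw [hk, hr, div_mul_cancel₀ _ hT0]
  have hk3 : k * (T.card : ℤ) = ((S.card ^ 2 * weightEnumerator T y : ℕ) : ℤ) := by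
    exact_mod_cast hk2
  have hdvd : p ∣ S.card ^ 2 * weightEnumerator T y := by
    rw [← Int.natCast_dvd_natCast, ← hk3]
    exact Dvd.dvd.mul_left (Int.natCast_dvd_natCast.mpr hpT) k
  exact (hp.dvd_mul.mp hdvd).resolve_left fun h' => hpS (hp.dvd_of_dvd_pow h')

/-- If `T` is invariant under translation by `m ≠ 0`, then its Fourier transform, and with it
`ν_S`, is supported on the proper subgroup `{z | m z = 0}`. -/
theorem not_isPrimitiveSubset (h : IsFormallyDual S T) {m : ZMod N} (hm : m ≠ 0)
    (hT : ∀ t ∈ T, t + m ∈ T) : ¬ IsPrimitiveSubset S := by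
  intro hprim
  obtain ⟨a, ha⟩ := h.1
  refine hprim (AddMonoidHom.mulLeft m).ker a ?_ ?_
  · intro htop
    have h1 : (1 : ZMod N) ∈ (AddMonoidHom.mulLeft m).ker := htop ▸ AddSubgroup.mem_top _
    exact hm (by simpa [AddMonoidHom.mem_ker] using h1)
  · intro s hs
    rw [AddMonoidHom.mem_ker, AddMonoidHom.coe_mulLeft]
    set z := s - a with hz
    have hpos : weightEnumerator S z ≠ 0 :=
      Finset.card_ne_zero_of_mem (a := (s, a)) (by simp [hs, ha, hz])
    have hne : ∑ x ∈ T, (ZMod.stdAddChar (x * z) : ℂ) ≠ 0 := by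
      intro h0
      have h1 := h.symm.2.2 z
      rw [h0, mul_zero, norm_zero] at h1
      have hS0 : (S.card : ℝ) ≠ 0 := by exact_mod_cast h.1.card_pos.ne'
      have hpos' : (weightEnumerator S z : ℝ) ≠ 0 := by exact_mod_cast hpos
      simp [hS0, hpos'] at h1
    have hshift : T.map (addRightEmbedding m) = T :=
      Finset.eq_of_subset_of_card_le
        (fun x hx => by
          obtain ⟨t, ht, rfl⟩ := Finset.mem_map.mp hx
          exact hT t ht)
        (Finset.card_map _).ge
    have hmul : ∑ x ∈ T, (ZMod.stdAddChar (x * z) : ℂ) =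
        (∑ x ∈ T, (ZMod.stdAddChar (x * z) : ℂ)) * ZMod.stdAddChar (m * z) := by
      conv_lhs => rw [← hshift]
      rw [Finset.sum_map, Finset.sum_mul]
      refine Finset.sum_congr rfl fun x _ => ?_
      rw [addRightEmbedding_apply, add_mul, AddChar.map_add_eq_mul]
    have h1 : (ZMod.stdAddChar (m * z) : ℂ) = 1 := (mul_eq_left₀ hne).mp hmul.symm
    rw [← AddChar.map_zero_eq_one (ZMod.stdAddChar (N := N))] at h1
    exact ZMod.injective_stdAddChar h1

end IsFormallyDual

end Fourier

/-! ### Self-conjugacy and the modular group algebra -/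

/-- In characteristic `p`, let `c = ∑ [g i]` in the group algebra of a group on which
multiplication by `p` is injective. If `p ^ n` acts on the `g i` as `-1` and `c c* = 0`, where
`c* = ∑ [-g i]`, then `c = 0`: the Frobenius map turns `c c*` into a power of `c`, and it is
injective on sums of group elements. -/
theorem AddMonoidAlgebra.sum_single_eq_zero {k G ι : Type*} [Field k] [AddCommGroup G]
    (p : ℕ) [Fact p.Prime] [CharP k p] (hinj : Function.Injective fun g : G => p • g)
    (s : Finset ι) (g : ι → G) (n : ℕ) (hn : ∀ i, p ^ n • g i = -g i)
    (h : ∑ i ∈ s, ∑ j ∈ s, AddMonoidAlgebra.single (g i - g j) (1 : k) = 0) :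
    ∑ i ∈ s, AddMonoidAlgebra.single (g i) (1 : k) = 0 := by
  have : CharP (AddMonoidAlgebra k G) p :=
    charP_of_injective_algebraMap (algebraMap k (AddMonoidAlgebra k G)).injective p
  set c : AddMonoidAlgebra k G := ∑ i ∈ s, AddMonoidAlgebra.single (g i) (1 : k) with hc
  have hpow (e : ℕ) : c ^ p ^ e = ∑ i ∈ s, AddMonoidAlgebra.single (p ^ e • g i) (1 : k) := by
    rw [hc, sum_pow_char_pow]
    simp [AddMonoidAlgebra.single_pow]
  have hnil : c ^ (p ^ n + 1) = 0 := by
    rw [pow_succ', hpow, hc, Finset.sum_mul_sum, ← h]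
    simp [AddMonoidAlgebra.single_mul_single, hn, sub_eq_add_neg]
  have hinj' (e : ℕ) : Function.Injective fun g : G => p ^ e • g := by
    induction e with
    | zero => intro a b hab; simpa using hab
    | succ e ih =>
      intro a b hab
      simp only [pow_succ, mul_smul] at hab
      exact hinj (ih hab)
  set e := p ^ n + 1 with he
  have hzero : c ^ p ^ e = 0 :=
    pow_eq_zero_of_le (Nat.lt_pow_self (Fact.out : p.Prime).one_lt).le hnil
  rw [hpow] at hzero
  classical
  ext a
  have := congrArg (fun x => x.coeff (p ^ e • a)) hzero
  simpa [hc, Finsupp.single_apply, (hinj' e).eq_iff] using this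

/-! ### Invariance under translation -/

/-- A fibre of `ℤ/pm → ℤ/m` has only `p` elements, so that a subset whose fibres have cardinalities
divisible by `p` is a union of fibres. -/
theorem add_mem_of_dvd_card_fiber {p m : ℕ} [NeZero (p * m)] (hpm : p.Coprime m)
    (T : Finset (ZMod (p * m)))
    (hT : ∀ a : ZMod m, p ∣ {t ∈ T | (t.cast : ZMod m) = a}.card) :
    ∀ t ∈ T, t + (m : ZMod (p * m)) ∈ T := by
  intro t ht
  have hdvd : m ∣ p * m := dvd_mul_left m p
  have hp0 : NeZero p := ⟨left_ne_zero_of_mul (NeZero.ne (p * m))⟩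
  set F : Finset (ZMod (p * m)) := {x | (x.cast : ZMod m) = t.cast} with hF
  have hcard : F.card ≤ p := by
    have hle : F.card ≤ (Finset.univ : Finset (ZMod p)).card := by
      refine Finset.card_le_card_of_injOn (fun x => (ZMod.chineseRemainder hpm x).1)
        (fun _ _ => Finset.mem_coe.mpr (Finset.mem_univ _)) ?_
      intro x hx y hy hxy
      simp only [hF, Finset.coe_filter, Finset.mem_univ, true_and, Set.mem_ofPred_eq] at hx hy
      refine (ZMod.chineseRemainder hpm).injective (Prod.ext hxy ?_)
      have h2 (x : ZMod (p * m)) : (ZMod.chineseRemainder hpm x).2 = (x.cast : ZMod m) := by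
        have := RingHom.congr_fun (Subsingleton.elim
          ((RingHom.snd (ZMod p) (ZMod m)).comp (ZMod.chineseRemainder hpm).toRingHom)
          (ZMod.castHom hdvd (ZMod m))) x
        simpa using this
      rw [h2, h2, hx, hy]
    simpa [ZMod.card] using hle
  have hsub : {x ∈ T | (x.cast : ZMod m) = t.cast} ⊆ F := fun x hx => by
    simpa [hF] using (Finset.mem_filter.mp hx).2
  have hpos : 0 < {x ∈ T | (x.cast : ZMod m) = t.cast}.card :=
    Finset.card_pos.mpr ⟨t, by simp [ht]⟩
  have heq := Finset.eq_of_subset_of_card_le hsub (hcard.trans (Nat.le_of_dvd hpos (hT t.cast)))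
  have hmem : t + (m : ZMod (p * m)) ∈ F := by
    simp [hF, ZMod.cast_add hdvd, ZMod.cast_natCast hdvd]
  rw [← heq] at hmem
  exact (Finset.mem_filter.mp hmem).1

/-- The case of a formally dual pair in which `p` divides the size of the second set. -/
theorem IsFormallyDual.not_isPrimitiveSubset_of_dvd {p m : ℕ} [NeZero (p * m)] (hp : p.Prime)
    (hpm : p.Coprime m) {n : ℕ} (hn : (p : ZMod m) ^ n = -1) {S T : Finset (ZMod (p * m))}
    (h : IsFormallyDual S T) (hpT : p ∣ T.card) (hpS : ¬ p ∣ S.card) :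
    ¬ IsPrimitiveSubset S := by
  have : Fact p.Prime := ⟨hp⟩
  have hdvd : m ∣ p * m := dvd_mul_left m p
  have hm0 : m ≠ 0 := right_ne_zero_of_mul (NeZero.ne (p * m))
  have hm : (m : ZMod (p * m)) ≠ 0 := by
    rw [Ne, ZMod.natCast_eq_zero_iff]
    intro hd
    have := Nat.le_of_dvd (Nat.pos_of_ne_zero hm0) hd
    nlinarith [hp.two_le, Nat.pos_of_ne_zero hm0]
  refine h.not_isPrimitiveSubset hm (add_mem_of_dvd_card_fiber hpm T fun a => ?_)
  have hunit : IsUnit (p : ZMod m) := (ZMod.isUnit_iff_coprime p m).mpr hpm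
  have key := AddMonoidAlgebra.sum_single_eq_zero (k := ZMod p) p (G := ZMod m)
    (fun x y hxy => by
      simp only [nsmul_eq_mul] at hxy
      exact hunit.mul_left_cancel hxy)
    T (fun t => t.cast) n (fun t => by simp [hn])
    (by
      have h1 := sum_weightEnumerator_smul T
        fun y => AddMonoidAlgebra.single (y.cast : ZMod m) (1 : ZMod p)
      simp only [ZMod.cast_sub hdvd] at h1
      rw [← h1]
      refine Finset.sum_eq_zero fun y _ => ?_
      obtain ⟨d, hd⟩ := h.dvd_weightEnumerator hp hpT hpS y
      rw [hd, mul_comm, mul_smul]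
      rw [AddMonoidAlgebra.smul_single]
      simp)
  have := congrArg (fun x => x.coeff a) key
  rw [← ZMod.natCast_eq_zero_iff, Finset.card_filter]
  simpa [Finsupp.single_apply] using this

/-- The hypothesis `hj` says that `p ^ j ≡ -1` modulo `N / p` for some integer `j`, possibly
negative: `u` is the residue class of `p`, as a unit modulo `N / p`. -/
theorem mainTheorem2 (N p : ℕ) [NeZero N] (hp : p.Prime) (hpN : p ∣ N) (hpN2 : ¬ p ^ 2 ∣ N)
    (hj : ∃ (u : (ZMod (N / p))ˣ) (j : ℤ), (u : ZMod (N / p)) = (p : ZMod (N / p)) ∧ u ^ j = -1) :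
    ¬ ∃ S T : Finset (ZMod N),
      IsPrimitiveSubset S ∧ IsPrimitiveSubset T ∧ IsFormallyDual S T := by
  rintro ⟨S, T, hS, hT, h⟩
  obtain ⟨m, rfl⟩ := hpN
  rw [Nat.mul_div_cancel_left m hp.pos] at hj
  obtain ⟨u, j, hu, huj⟩ := hj
  have hm0 : NeZero m := ⟨right_ne_zero_of_mul (NeZero.ne (p * m))⟩
  have hpm : p.Coprime m := (Nat.Prime.coprime_iff_not_dvd hp).mpr fun hd =>
    hpN2 (by rw [sq]; exact mul_dvd_mul_left p hd)
  -- The unit group is finite, so `j` may be taken to be a natural number.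
  obtain ⟨n, hn⟩ : (-1 : (ZMod m)ˣ) ∈ Submonoid.powers u :=
    mem_powers_iff_mem_zpowers.mpr ⟨j, huj⟩
  have hn' : (p : ZMod m) ^ n = -1 := by
    rw [← hu]
    simpa using congrArg Units.val hn
  have hcard := h.card_mul_card
  have hnot : ¬ (p ∣ S.card ∧ p ∣ T.card) := fun ⟨h1, h2⟩ =>
    hpN2 (by rw [sq, ← hcard]; exact mul_dvd_mul h1 h2)
  rcases hp.dvd_mul.mp (hcard ▸ dvd_mul_right p m) with h1 | h1
  · exact h.symm.not_isPrimitiveSubset_of_dvd hp hpm hn' h1 (fun h2 => hnot ⟨h1, h2⟩) hT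
  · exact h.not_isPrimitiveSubset_of_dvd hp hpm hn' h1 (fun h2 => hnot ⟨h2, h1⟩) hS
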